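/- Let $1\le q\le n$ be integers, let $J$ be a real symmetric $n\times n$ matrix with zero diagonal (the interaction matrix of an Ising model on $[n]$), and define its variational (mean-field) free energy by $$\mathcal F^* := \max_{x\in[-1,1]^n}\Big[\sum_{i,j=1}^n J_{i,j}x_ix_j+\sum_{i=1}^n H\Big(\frac{1+x_i}{2}\Big)\Big],$$ where $H(p)=-p\log p-(1-p)\log(1-p)$ is the binary entropy (natural logarithm, $0\log 0=0$). Let $Q$ be a uniformly random subset of $[n]$ of size $|Q|=q$, let $J_Q$ be the restriction of the matrix $\frac nq J$ to $Q\times Q$, and let $\mathcal F^*_Q$ be the variational free energy of the Ising model on the vertex set $Q$ with interaction matrix $J_Q$ (the same maximum, over $x\in[-1,1]^Q$). Write $\|J\|_F=\big(\sum_{i,j}J_{i,j}^2\big)^{1/2}$ and $\|\vec J\|_\infty=\max_{i,j}|J_{i,j}|$. Let $0<\epsilon\le 1$ and suppose $q\ge 128000\,\omega$, where $\omega:=\log(1/\epsilon)/\epsilon^{8}$. Then, with probability at least $39/40$ over the choice of $Q$, $$\Big|\mathcal F^*-\frac nq\,\mathcal F^*_Q\Big|\le 2000\,\epsilon n\Big(\|J\|_F+\epsilon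 n\|\vec J\|_\infty+\frac{\omega}{q}\Big).$$ -/

import Mathlib

/-- The mean-field objective at `x`: `∑ᵢⱼ Jᵢⱼ xᵢ xⱼ + ∑ᵢ H((xᵢ + 1)/2)`, where `H` is the binary
entropy with natural logarithms. -/
noncomputable def meanFieldObjective {V : Type*} [Fintype V] (J : Matrix V V ℝ) (x : V → ℝ) : ℝ :=
  ∑ i, ∑ j, J i j * x i * x j + ∑ i, Real.binEntropy ((x i + 1) / 2)

/-- The variational (mean-field) free energy `F*` of the Ising model with interaction matrix `J`:
the maximum of the mean-field objective over the cube `[-1, 1]^V`. -/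
noncomputable def variationalFreeEnergy {V : Type*} [Fintype V] (J : Matrix V V ℝ) : ℝ :=
  sSup (meanFieldObjective J '' {x : V → ℝ | ∀ i, x i ∈ Set.Icc (-1 : ℝ) 1})

/-- The supremum defining `variationalFreeEnergy` is attained. -/
theorem variationalFreeEnergy_isGreatest {V : Type*} [Fintype V] (J : Matrix V V ℝ) :
    IsGreatest (meanFieldObjective J '' {x : V → ℝ | ∀ i, x i ∈ Set.Icc (-1 : ℝ) 1})
      (variationalFreeEnergy J) := by
  have hc : IsCompact {x : V → ℝ | ∀ i, x i ∈ Set.Icc (-1 : ℝ) 1} :=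
    isCompact_pi_infinite fun _ => isCompact_Icc
  have hf : Continuous (meanFieldObjective J) := by
    unfold meanFieldObjective
    have := Real.binEntropy_continuous
    fun_prop
  refine (hc.image hf).isGreatest_sSup (Set.Nonempty.image _ ⟨0, fun i => ?_⟩)
  simp

/-- The Frobenius norm `‖J‖_F`. -/
noncomputable def frobNorm {V : Type*} [Fintype V] (J : Matrix V V ℝ) : ℝ :=
  Real.sqrt (∑ i, ∑ j, J i j ^ 2)

/-- The largest absolute value of an entry of `J`. -/
noncomputable def maxEntry {V : Type*} (J : Matrix V V ℝ) : ℝ :=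
  ⨆ p : V × V, |J p.1 p.2|

/-- The interaction matrix `J_Q` of the sampled model on the vertex set `Q`: the restriction of
`(n / |Q|) J` to `Q × Q`. -/
noncomputable def sampledMatrix {n : ℕ} (J : Matrix (Fin n) (Fin n) ℝ) (Q : Finset (Fin n)) :
    Matrix Q Q ℝ :=
  fun i j => (n : ℝ) / (Q.card : ℝ) * J i j

open Classical in
/-- The probability that a uniformly random subset `Q` of `[n]` with exactly `q` elements
satisfies `P`. -/
noncomputable def randomSubsetProb (n q : ℕ) (P : Finset (Fin n) → Prop) : ℝ :=
  (((Finset.univ : Finset (Fin n)).powersetCard q).filter P).card /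
    ((Finset.univ : Finset (Fin n)).powersetCard q).card

/-!
Write `φ(t) = max_{x ∈ [-1,1]} (t x + H((x+1)/2))`, a `1`-Lipschitz function. The difference between
the two free energies is controlled by how well `∑ᵢ φ(hᵢ)` is estimated from the sample `Q`, for
fields `h = J z` with `|z_j| ≤ 1 + (n/q) 1_Q(j)`.

*Reduction.* Let `x` be optimal on `Q` and `z₀ = (n/q) x 1_Q`. A maximiser `y` of
`yᵀJy/2 + (Jz₀)·y + ∑ᵢ H((yᵢ+1)/2)` over the cube is, coordinate by coordinate, an optimal response
to the field `h = J(z₀ + y)`, because `J` has zero diagonal (`exists_best_response`). Hence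
`∑ᵢ φ(hᵢ) = h·y + ∑ᵢ H((yᵢ+1)/2)`, while `(n/q) ∑_Q φ(hᵢ) ≥ h·z₀ + (n/q) ∑_Q H((xᵢ+1)/2)`, and
`h·(y - z₀) = yᵀJy - z₀ᵀJz₀` by symmetry. So `(n/q) F*_Q - F*` is at most the sampling error of
`∑ φ(hᵢ)` (`sampled_sub_full_le`). With the roles of `Q` and `[n]` exchanged this gives the opposite
inequality (`full_sub_sampled_le`).

*Empirical process.* The vector `z` may depend on `Q`, so a bound on the expected sampling error has
to be uniform in `z`. A uniform `Q` is produced from a random bijection in which `m = min(q, n - q)`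
sampled elements are paired with unsampled ones. Exchanging the members of the pairs at random keeps
the bijection uniform and turns the expected sampling error into a Rademacher average of
`φ((Jz)_i)`, over all `z` supported, up to the uniform part, on the at most `2q` elements that may
enter the sample (`Position.sum_pair_differences_le`). The contraction principle
(`rademacher_contraction`) removes `φ`, and what is left is a linear functional of `z`, bounded by
second moments (`rademacher_lipschitz_linear_le`). The expected sampling error is thus at most
`6 n² ‖J‖_∞ / √q` (`sum_samplingError_le`).

Markov's inequality, applied once for each sign, gives failure probability at most `1/40` at the
level `480 n² ‖J‖_∞ / √q`, which the hypothesis on `q` makes at most `2000 ε² n² ‖J‖_∞`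
(`le_sq_mul_sqrt`). The Frobenius and `ω / q` terms of the bound enter only through being
nonnegative.
-/

open Finset Matrix

/-! ### The Legendre transform of the entropy -/

/-- The Legendre transform of the binary entropy on `[-1, 1]`: the free energy of a single spin in
an external field `t`. -/
noncomputable def spinFreeEnergy (t : ℝ) : ℝ :=
  sSup ((fun x : ℝ => t * x + Real.binEntropy ((x + 1) / 2)) '' Set.Icc (-1) 1)

theorem spinFreeEnergy_isGreatest (t : ℝ) :
    IsGreatest ((fun x : ℝ => t * x + Real.binEntropy ((x + 1) / 2)) '' Set.Icc (-1) 1)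
      (spinFreeEnergy t) := by
  refine (isCompact_Icc.image ?_).isGreatest_sSup (Set.Nonempty.image _ ⟨0, by simp⟩)
  have := Real.binEntropy_continuous
  fun_prop

theorem le_spinFreeEnergy (t : ℝ) {x : ℝ} (hx : x ∈ Set.Icc (-1 : ℝ) 1) :
    t * x + Real.binEntropy ((x + 1) / 2) ≤ spinFreeEnergy t :=
  (spinFreeEnergy_isGreatest t).2 ⟨x, hx, rfl⟩

theorem spinFreeEnergy_le {t b : ℝ}
    (h : ∀ x ∈ Set.Icc (-1 : ℝ) 1, t * x + Real.binEntropy ((x + 1) / 2) ≤ b) :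
    spinFreeEnergy t ≤ b := by
  obtain ⟨x, hx, e⟩ := (spinFreeEnergy_isGreatest t).1
  exact e ▸ h x hx

theorem abs_spinFreeEnergy_sub_le (s t : ℝ) :
    |spinFreeEnergy s - spinFreeEnergy t| ≤ |s - t| := by
  have key : ∀ s t : ℝ, spinFreeEnergy s - spinFreeEnergy t ≤ |s - t| := by
    intro s t
    rw [sub_le_iff_le_add]
    refine spinFreeEnergy_le fun x hx => ?_
    have h1 := le_spinFreeEnergy t hx
    have h2 : (s - t) * x ≤ |s - t| :=
      (le_abs_self _).trans (by
        rw [abs_mul]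
        exact mul_le_of_le_one_right (abs_nonneg _) (abs_le.2 hx))
    linarith
  rw [abs_sub_le_iff]
  exact ⟨key s t, abs_sub_comm s t ▸ key t s⟩

/-- A system of spins has a configuration in which every spin is the optimal response to the field
that the other spins and `b` exert on it: a maximiser of `yᵀJy/2 + b·y + ∑ᵢ H((yᵢ+1)/2)`. As `J` has
zero diagonal, the field at `i` does not involve `y i`, so that optimality is exact rather than a
first-order condition. -/
theorem exists_best_response {V : Type*} [Fintype V] {J : Matrix V V ℝ} (hsymm : J.IsSymm)
    (hdiag : ∀ i, J i i = 0) (b : V → ℝ) :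
    ∃ y : V → ℝ, (∀ i, y i ∈ Set.Icc (-1 : ℝ) 1) ∧
      ∀ i, spinFreeEnergy (b i + (J *ᵥ y) i) =
        (b i + (J *ᵥ y) i) * y i + Real.binEntropy ((y i + 1) / 2) := by
  classical
  let G : (V → ℝ) → ℝ := fun y =>
    (∑ i, y i * (J *ᵥ y) i) / 2 + ∑ i, (b i * y i + Real.binEntropy ((y i + 1) / 2))
  have hc : IsCompact {x : V → ℝ | ∀ i, x i ∈ Set.Icc (-1 : ℝ) 1} :=
    isCompact_pi_infinite fun _ => isCompact_Icc
  have hf : Continuous G := by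
    have := Real.binEntropy_continuous
    simp only [G, mulVec, dotProduct]
    fun_prop
  obtain ⟨y, hy, hmax⟩ := hc.exists_isMaxOn ⟨0, fun i => by simp⟩ hf.continuousOn
  refine ⟨y, hy, fun i =>
    le_antisymm (spinFreeEnergy_le fun x hx => ?_) (le_spinFreeEnergy _ (hy i))⟩
  -- compare `y` with the configuration in which the spin `i` is replaced by `x`
  have hmem : Function.update y i x ∈ {x : V → ℝ | ∀ i, x i ∈ Set.Icc (-1 : ℝ) 1} := by
    intro j
    by_cases h : j = i
    · subst h; simpa using hx
    · simpa [h] using hy j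
  have hle : G (Function.update y i x) ≤ G y := hmax hmem
  have hupd : Function.update y i x = y + Pi.single i (x - y i) := by
    ext j
    by_cases h : j = i
    · subst h; simp
    · simp [h]
  have hquad : ∑ j, Function.update y i x j * (J *ᵥ Function.update y i x) j =
      ∑ j, y j * (J *ᵥ y) j + 2 * ((x - y i) * (J *ᵥ y) i) := by
    change Function.update y i x ⬝ᵥ (J *ᵥ Function.update y i x) = y ⬝ᵥ (J *ᵥ y) + _
    have h1 : y ⬝ᵥ (J *ᵥ Pi.single i (x - y i)) = (x - y i) * (J *ᵥ y) i := by
      rw [dotProduct_mulVec, ← mulVec_transpose, hsymm.eq, dotProduct_single, mul_comm]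
    have h2 : (J *ᵥ Pi.single i (x - y i)) i = 0 := by
      simp [mulVec, hdiag]
    rw [hupd, mulVec_add, add_dotProduct, dotProduct_add, dotProduct_add, h1, single_dotProduct,
      single_dotProduct, h2]
    ring
  have hlin : ∑ j, (b j * Function.update y i x j +
        Real.binEntropy ((Function.update y i x j + 1) / 2)) =
      ∑ j, (b j * y j + Real.binEntropy ((y j + 1) / 2)) +
        ((b i * x + Real.binEntropy ((x + 1) / 2)) -
          (b i * y i + Real.binEntropy ((y i + 1) / 2))) := by
    rw [← Finset.add_sum_erase _ _ (mem_univ i), ← Finset.add_sum_erase univ _ (mem_univ i)]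
    have : ∀ j ∈ univ.erase i, Function.update y i x j = y j := fun j hj => by
      simp [ne_of_mem_erase hj]
    rw [Finset.sum_congr rfl fun j hj => by rw [this j hj]]
    simp
    ring
  simp only [G] at hle
  rw [hquad, hlin] at hle
  linarith

/-! ### Comparison of the free energies through a sampling discrepancy -/

/-- The error made when `∑ᵢ φ (hᵢ)` is estimated from the sample `Q`. -/
noncomputable def samplingError {V : Type*} [Fintype V] (φ : ℝ → ℝ) (Q : Finset V) (h : V → ℝ) :
    ℝ :=
  (Fintype.card V : ℝ) / (#Q : ℝ) * ∑ i ∈ Q, φ (h i) - ∑ i, φ (h i)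

/-- The quadratic form of the sampled model is the one of `J` at the rescaled indicator extension
of `x`. -/
theorem sampled_objective {n : ℕ} (J : Matrix (Fin n) (Fin n) ℝ) (Q : Finset (Fin n))
    (x : Fin n → ℝ) (z : Fin n → ℝ)
    (hz : z = fun i => if i ∈ Q then (n : ℝ) / (#Q : ℝ) * x i else 0) :
    (n : ℝ) / (#Q : ℝ) * meanFieldObjective (sampledMatrix J Q) (fun i : Q => x i) =
      z ⬝ᵥ (J *ᵥ z) + (n : ℝ) / (#Q : ℝ) * ∑ i ∈ Q, Real.binEntropy ((x i + 1) / 2) := by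
  have h1 : z ⬝ᵥ (J *ᵥ z) = ∑ i ∈ Q, ∑ j ∈ Q,
      ((n : ℝ) / (#Q : ℝ) * x i) * (J i j * ((n : ℝ) / (#Q : ℝ) * x j)) := by
    simp only [dotProduct, mulVec, hz, ite_mul, zero_mul, Finset.sum_ite_mem, univ_inter]
    simp only [mul_ite, mul_zero, Finset.sum_ite_mem, univ_inter, Finset.mul_sum]
  rw [h1, meanFieldObjective, mul_add, Finset.mul_sum]
  congr 1
  · rw [← Finset.sum_coe_sort Q]
    refine Finset.sum_congr rfl fun i _ => ?_
    rw [Finset.mul_sum, ← Finset.sum_coe_sort Q]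
    refine Finset.sum_congr rfl fun j _ => ?_
    simp only [sampledMatrix]
    ring
  · rw [← Finset.sum_coe_sort Q]

theorem objective_eq {V : Type*} [Fintype V] (J : Matrix V V ℝ) (y : V → ℝ) :
    meanFieldObjective J y = y ⬝ᵥ (J *ᵥ y) + ∑ i, Real.binEntropy ((y i + 1) / 2) := by
  simp only [meanFieldObjective, dotProduct, mulVec, Finset.mul_sum]
  congr 1
  refine Finset.sum_congr rfl fun i _ => Finset.sum_congr rfl fun j _ => by ring

/-- `⟨J(z + y), y - z⟩` is a difference of values of the quadratic form. -/
theorem symm_polarization {V : Type*} [Fintype V] {J : Matrix V V ℝ} (hsymm : J.IsSymm)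
    (y z : V → ℝ) :
    (J *ᵥ (z + y)) ⬝ᵥ y - (J *ᵥ (z + y)) ⬝ᵥ z = y ⬝ᵥ (J *ᵥ y) - z ⬝ᵥ (J *ᵥ z) := by
  have h1 : (J *ᵥ z) ⬝ᵥ y = (J *ᵥ y) ⬝ᵥ z := by
    rw [dotProduct_comm, dotProduct_mulVec, ← mulVec_transpose, hsymm.eq]
  rw [mulVec_add, add_dotProduct, add_dotProduct, h1, dotProduct_comm (J *ᵥ y) y,
    dotProduct_comm (J *ᵥ z) z]
  ring

theorem dotProduct_extension {V : Type*} [Fintype V] [DecidableEq V] (Q : Finset V) (r : ℝ)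
    (h x : V → ℝ) :
    h ⬝ᵥ (fun i => if i ∈ Q then r * x i else 0) = r * ∑ i ∈ Q, h i * x i := by
  simp only [dotProduct, mul_ite, mul_zero, Finset.sum_ite_mem, univ_inter, Finset.mul_sum]
  exact Finset.sum_congr rfl fun i _ => by ring

theorem abs_extension_add_le {V : Type*} [DecidableEq V] (Q : Finset V) {r : ℝ} (hr : 0 ≤ r)
    {x y : V → ℝ} (hx : ∀ i, x i ∈ Set.Icc (-1 : ℝ) 1) (hy : ∀ i, y i ∈ Set.Icc (-1 : ℝ) 1)
    (j : V) :
    |(if j ∈ Q then r * x j else 0) + y j| ≤ 1 + if j ∈ Q then r else 0 := by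
  have h1 := abs_le.2 (hy j)
  have h2 := abs_le.2 (hx j)
  refine (abs_add_le _ _).trans ?_
  split_ifs
  · rw [abs_mul, abs_of_nonneg hr]
    nlinarith [mul_le_of_le_one_right hr h2]
  · simpa using h1

/-- The sampled free energy exceeds the full one by at most a sampling error. From an optimal `x` on
`Q` a configuration of the full system is built as the response to `z = (n/q) x 1_Q`. -/
theorem sampled_sub_full_le {n : ℕ} {J : Matrix (Fin n) (Fin n) ℝ} (hsymm : J.IsSymm)
    (hdiag : ∀ i, J i i = 0) (Q : Finset (Fin n)) :
    ∃ z : Fin n → ℝ, (∀ j, |z j| ≤ 1 + if j ∈ Q then (n : ℝ) / (#Q : ℝ) else 0) ∧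
      (n : ℝ) / (#Q : ℝ) * variationalFreeEnergy (sampledMatrix J Q) - variationalFreeEnergy J ≤
        samplingError spinFreeEnergy Q (J *ᵥ z) := by
  obtain ⟨x₀, hx₀, hx₀e⟩ := (variationalFreeEnergy_isGreatest (sampledMatrix J Q)).1
  set r : ℝ := (n : ℝ) / (#Q : ℝ) with hr
  have hr0 : 0 ≤ r := by positivity
  obtain ⟨x, rfl, hx⟩ : ∃ x : Fin n → ℝ, (fun i : Q => x i) = x₀ ∧
      ∀ i, x i ∈ Set.Icc (-1 : ℝ) 1 := by
    refine ⟨fun i => if h : i ∈ Q then x₀ ⟨i, h⟩ else 0, by ext i; simp, fun i => ?_⟩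
    by_cases h : i ∈ Q
    · simpa [h] using hx₀ ⟨i, h⟩
    · simp [h]
  set z : Fin n → ℝ := fun i => if i ∈ Q then r * x i else 0 with hz
  obtain ⟨y, hy, hopt⟩ := exists_best_response hsymm hdiag (J *ᵥ z)
  refine ⟨z + y, fun j => abs_extension_add_le Q hr0 hx hy j, ?_⟩
  set h := J *ᵥ (z + y) with hh
  have hfull : ∑ i, spinFreeEnergy (h i) = h ⬝ᵥ y + ∑ i, Real.binEntropy ((y i + 1) / 2) := by
    rw [dotProduct, ← Finset.sum_add_distrib]
    refine Finset.sum_congr rfl fun i _ => ?_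
    rw [hh, mulVec_add]
    exact hopt i
  have hQ : h ⬝ᵥ z + r * ∑ i ∈ Q, Real.binEntropy ((x i + 1) / 2) ≤
      r * ∑ i ∈ Q, spinFreeEnergy (h i) := by
    rw [hz, dotProduct_extension, ← mul_add, ← Finset.sum_add_distrib]
    exact mul_le_mul_of_nonneg_left
      (Finset.sum_le_sum fun i _ => le_spinFreeEnergy _ (hx i)) hr0
  have hF := (variationalFreeEnergy_isGreatest J).2 ⟨y, hy, rfl⟩
  have hp := symm_polarization hsymm y z
  rw [objective_eq] at hF
  rw [← hx₀e, sampled_objective J Q x z hz, samplingError, Fintype.card_fin, ← hr]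
  rw [← hh] at hp
  linarith

/-- The full free energy exceeds the sampled one by at most a sampling error. From an optimal `y` for
the full system a configuration on `Q` is built as the response to `y`. -/
theorem full_sub_sampled_le {n : ℕ} {J : Matrix (Fin n) (Fin n) ℝ} (hsymm : J.IsSymm)
    (hdiag : ∀ i, J i i = 0) (Q : Finset (Fin n)) :
    ∃ z : Fin n → ℝ, (∀ j, |z j| ≤ 1 + if j ∈ Q then (n : ℝ) / (#Q : ℝ) else 0) ∧
      variationalFreeEnergy J - (n : ℝ) / (#Q : ℝ) * variationalFreeEnergy (sampledMatrix J Q) ≤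
        - samplingError spinFreeEnergy Q (J *ᵥ z) := by
  obtain ⟨y, hy, hye⟩ := (variationalFreeEnergy_isGreatest J).1
  set r : ℝ := (n : ℝ) / (#Q : ℝ) with hr
  have hr0 : 0 ≤ r := by positivity
  have hsymmQ : (sampledMatrix J Q).IsSymm := by
    ext i j
    simp [sampledMatrix, hsymm.apply i.1 j.1]
  obtain ⟨x₀, hx₀, hopt⟩ := exists_best_response hsymmQ
    (fun i => by simp [sampledMatrix, hdiag]) (fun i : Q => (J *ᵥ y) i)
  obtain ⟨x, rfl, hx⟩ : ∃ x : Fin n → ℝ, (fun i : Q => x i) = x₀ ∧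
      ∀ i, x i ∈ Set.Icc (-1 : ℝ) 1 := by
    refine ⟨fun i => if h : i ∈ Q then x₀ ⟨i, h⟩ else 0, by ext i; simp, fun i => ?_⟩
    by_cases h : i ∈ Q
    · simpa [h] using hx₀ ⟨i, h⟩
    · simp [h]
  set z : Fin n → ℝ := fun i => if i ∈ Q then r * x i else 0 with hz
  refine ⟨z + y, fun j => abs_extension_add_le Q hr0 hx hy j, ?_⟩
  set h := J *ᵥ (z + y) with hh
  have hfield : ∀ i : Q, (J *ᵥ y) i + (sampledMatrix J Q *ᵥ fun i : Q => x i) i = h i := by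
    intro i
    have : (J *ᵥ z) i = (sampledMatrix J Q *ᵥ fun i : Q => x i) i := by
      rw [mulVec, hz, dotProduct_extension, mulVec, dotProduct, Finset.mul_sum,
        ← Finset.sum_coe_sort Q]
      refine Finset.sum_congr rfl fun j _ => ?_
      simp only [sampledMatrix]
      ring
    rw [hh, mulVec_add, Pi.add_apply, this, add_comm]
  have hQ : r * ∑ i ∈ Q, spinFreeEnergy (h i) =
      h ⬝ᵥ z + r * ∑ i ∈ Q, Real.binEntropy ((x i + 1) / 2) := by
    rw [hz, dotProduct_extension, ← mul_add, ← Finset.sum_add_distrib, ← Finset.sum_coe_sort Q,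
      ← Finset.sum_coe_sort Q]
    congr 1
    refine Finset.sum_congr rfl fun i _ => ?_
    rw [← hfield i]
    exact hopt i
  have hfull : h ⬝ᵥ y + ∑ i, Real.binEntropy ((y i + 1) / 2) ≤ ∑ i, spinFreeEnergy (h i) := by
    rw [dotProduct, ← Finset.sum_add_distrib]
    exact Finset.sum_le_sum fun i _ => le_spinFreeEnergy _ (hy i)
  have hF := mul_le_mul_of_nonneg_left
    ((variationalFreeEnergy_isGreatest (sampledMatrix J Q)).2
      ⟨fun i : Q => x i, fun i => hx i, rfl⟩) hr0
  have hp := symm_polarization hsymm y z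
  rw [sampled_objective J Q x z hz] at hF
  rw [← hye, objective_eq, samplingError, Fintype.card_fin, ← hr]
  rw [← hh] at hp
  linarith

/-! ### Rademacher sums -/

/-- The sign `±1` encoded by a Boolean. -/
def boolSign (b : Bool) : ℝ := if b then 1 else -1

theorem sum_pi_bool_succ {m : ℕ} (F : (Fin (m + 1) → Bool) → ℝ) :
    ∑ σ, F σ = ∑ σ : Fin m → Bool, (F (Fin.cons true σ) + F (Fin.cons false σ)) := by
  rw [← Fintype.sum_equiv (Fin.consEquiv fun _ => Bool) (fun p => F (Fin.cons p.1 p.2)) F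
    (fun _ => rfl), Fintype.sum_prod_type, Fintype.sum_bool, Finset.sum_add_distrib]

/-- The contraction principle for a single sign. -/
theorem iSup_add_add_iSup_sub_le {T : Type*} [Finite T] [Nonempty T] (A f g : T → ℝ)
    (hfg : ∀ s t, |f s - f t| ≤ |g s - g t|) :
    (⨆ t, (A t + f t)) + ⨆ t, (A t - f t) ≤ (⨆ t, (A t + g t)) + ⨆ t, (A t - g t) := by
  obtain ⟨s, hs⟩ := exists_eq_ciSup_of_finite (f := fun t => A t + f t)
  obtain ⟨t, ht⟩ := exists_eq_ciSup_of_finite (f := fun t => A t - f t)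
  rw [← hs, ← ht]
  have hp : ∀ u, A u + g u ≤ ⨆ t, (A t + g t) :=
    fun u => le_ciSup (f := fun t => A t + g t) (Set.finite_range _).bddAbove u
  have hm : ∀ u, A u - g u ≤ ⨆ t, (A t - g t) :=
    fun u => le_ciSup (f := fun t => A t - g t) (Set.finite_range _).bddAbove u
  have h1 := (le_abs_self _).trans (hfg s t)
  rcases abs_cases (g s - g t) with ⟨h, -⟩ | ⟨h, -⟩
  · linarith [hp s, hm t]
  · linarith [hp t, hm s]

/-- Talagrand's contraction principle: applying a `1`-Lipschitz function does not increase a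
Rademacher average. The offset `A` carries the induction. -/
theorem rademacher_contraction {T : Type*} [Finite T] [Nonempty T] {φ : ℝ → ℝ}
    (hφ : ∀ a b, |φ a - φ b| ≤ |a - b|) {m : ℕ} (A : T → ℝ) (h : T → Fin m → ℝ) :
    ∑ σ : Fin m → Bool, ⨆ t, (A t + ∑ s, boolSign (σ s) * φ (h t s)) ≤
      ∑ σ : Fin m → Bool, ⨆ t, (A t + ∑ s, boolSign (σ s) * h t s) := by
  induction m generalizing A with
  | zero => simp
  | succ m ih =>
    rw [sum_pi_bool_succ, sum_pi_bool_succ]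
    simp only [Fin.sum_univ_succ, Fin.cons_zero, Fin.cons_succ, boolSign, if_true,
      Bool.false_eq_true, if_false, one_mul, neg_one_mul, ← add_assoc, ← sub_eq_add_neg]
    rw [Finset.sum_add_distrib]
    refine (add_le_add (ih (fun t => A t + φ (h t 0)) fun t s => h t s.succ)
      (ih (fun t => A t - φ (h t 0)) fun t s => h t s.succ)).trans ?_
    rw [← Finset.sum_add_distrib]
    refine Finset.sum_le_sum fun σ _ => ?_
    have := iSup_add_add_iSup_sub_le (fun t => A t + ∑ s, boolSign (σ s) * h t (Fin.succ s))
      (fun t => φ (h t 0)) (fun t => h t 0) fun s t => hφ _ _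
    simpa only [boolSign, add_right_comm, add_sub_right_comm] using this

theorem sum_rademacher_sq {m : ℕ} (a : Fin m → ℝ) :
    ∑ σ : Fin m → Bool, (∑ s, boolSign (σ s) * a s) ^ 2 = 2 ^ m * ∑ s, a s ^ 2 := by
  induction m with
  | zero => simp
  | succ m ih =>
    rw [sum_pi_bool_succ]
    simp only [Fin.sum_univ_succ, Fin.cons_zero, Fin.cons_succ]
    have : ∀ σ : Fin m → Bool,
        (boolSign true * a 0 + ∑ s, boolSign (σ s) * a s.succ) ^ 2 +
          (boolSign false * a 0 + ∑ s, boolSign (σ s) * a s.succ) ^ 2 =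
        2 * a 0 ^ 2 + 2 * (∑ s, boolSign (σ s) * a s.succ) ^ 2 := fun σ => by
      simp only [boolSign, if_true, Bool.false_eq_true, if_false]
      ring
    simp only [this]
    rw [Finset.sum_add_distrib, ← Finset.mul_sum, ← Finset.mul_sum, ih fun s => a s.succ]
    simp
    ring

theorem sum_abs_rademacher_le {m : ℕ} (a : Fin m → ℝ) {M : ℝ} (ha : ∀ s, |a s| ≤ M)
    (hM : 0 ≤ M) :
    ∑ σ : Fin m → Bool, |∑ s, boolSign (σ s) * a s| ≤ 2 ^ m * (√m * M) := by
  refine abs_le_of_sq_le_sq' ?_ (by positivity) |>.2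
  have h1 := sq_sum_le_card_mul_sum_sq (s := (univ : Finset (Fin m → Bool)))
    (f := fun σ => |∑ s, boolSign (σ s) * a s|)
  simp only [sq_abs, sum_rademacher_sq, card_univ, Fintype.card_fun, Fintype.card_bool,
    Fintype.card_fin, Nat.cast_pow, Nat.cast_ofNat] at h1
  have h2 : ∑ s, a s ^ 2 ≤ m * M ^ 2 := by
    refine (Finset.sum_le_card_nsmul _ _ (M ^ 2) fun s _ => ?_).trans (by simp)
    exact sq_le_sq' (abs_le.1 (ha s)).1 (abs_le.1 (ha s)).2
  have h3 : ((2 : ℝ) ^ m * (√m * M)) ^ 2 = 2 ^ m * (2 ^ m * (m * M ^ 2)) := by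
    rw [mul_pow, mul_pow, Real.sq_sqrt (Nat.cast_nonneg m)]
    ring
  rw [h3]
  exact h1.trans (by gcongr)

/-- Rademacher complexity of a family of `1`-Lipschitz images of the linear functions `A z`, where
`z` ranges over vectors with `|z j| ≤ c j`. -/
theorem rademacher_lipschitz_linear_le {T V : Type*} [Finite T] [Nonempty T] [Fintype V]
    {φ : ℝ → ℝ} (hφ : ∀ a b, |φ a - φ b| ≤ |a - b|) {m : ℕ} (A : Matrix (Fin m) V ℝ) {M : ℝ}
    (hM : 0 ≤ M) (hA : ∀ s j, |A s j| ≤ M) (z : T → V → ℝ) (c : V → ℝ)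
    (hz : ∀ t j, |z t j| ≤ c j) :
    ∑ σ : Fin m → Bool, ⨆ t, ∑ s, boolSign (σ s) * φ ((A *ᵥ z t) s) ≤
      2 ^ m * (√m * M * ∑ j, c j) := by
  have hc : ∀ j, 0 ≤ c j := fun j => (abs_nonneg _).trans (hz (Classical.arbitrary T) j)
  have h1 := rademacher_contraction hφ (fun _ : T => 0) fun t => A *ᵥ z t
  simp only [zero_add] at h1
  refine h1.trans ?_
  have h2 : ∀ σ : Fin m → Bool, ⨆ t, ∑ s, boolSign (σ s) * (A *ᵥ z t) s ≤
      ∑ j, c j * |∑ s, boolSign (σ s) * A s j| := by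
    refine fun σ => ciSup_le fun t => ?_
    have : ∑ s, boolSign (σ s) * (A *ᵥ z t) s = ∑ j, z t j * ∑ s, boolSign (σ s) * A s j := by
      simp only [mulVec, dotProduct, Finset.mul_sum]
      rw [Finset.sum_comm]
      exact Finset.sum_congr rfl fun j _ => Finset.sum_congr rfl fun s _ => by ring
    rw [this]
    refine Finset.sum_le_sum fun j _ => (le_abs_self _).trans ?_
    rw [abs_mul]
    exact mul_le_mul_of_nonneg_right (hz t j) (abs_nonneg _)
  refine (Finset.sum_le_sum fun σ _ => h2 σ).trans ?_
  rw [Finset.sum_comm, Finset.mul_sum, Finset.mul_sum]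
  refine Finset.sum_le_sum fun j _ => ?_
  rw [← Finset.mul_sum]
  calc c j * ∑ σ : Fin m → Bool, |∑ s, boolSign (σ s) * A s j|
      ≤ c j * (2 ^ m * (√m * M)) :=
        mul_le_mul_of_nonneg_left (sum_abs_rademacher_le _ (fun s => hA s j) hM) (hc j)
    _ = _ := by ring

/-! ### Sampling without replacement through random bijections -/

/-- Positions for the elements of a set of size `2m + k + l`: `m` pairs, whose `true` members are
sampled and whose `false` members are not, `k` further sampled positions, and `l` further positions
that are not sampled. -/
abbrev Position (m k l : ℕ) := (Fin m × Bool) ⊕ (Fin k ⊕ Fin l)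

namespace Position

variable {m k l : ℕ} {V : Type*} [Fintype V]

/-- Whether a position belongs to the sample. -/
def IsSampled : Position m k l → Bool
  | .inl p => p.2
  | .inr (.inl _) => true
  | .inr (.inr _) => false

/-- Whether a position belongs to the sample after some exchange within pairs. -/
def IsTouched : Position m k l → Bool
  | .inl _ => true
  | .inr (.inl _) => true
  | .inr (.inr _) => false

/-- The sample that a bijection from positions to `V` determines. -/
def sample (e : Position m k l ≃ V) : Finset V :=
  univ.filter fun v => (e.symm v).IsSampled

/-- The elements of `V` that some exchange within pairs brings into the sample. -/
def touched (e : Position m k l ≃ V) : Finset V :=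
  univ.filter fun v => (e.symm v).IsTouched

/-- Exchange the two members of each pair `s` with `σ s = false`. -/
def flipPairs (σ : Fin m → Bool) : Equiv.Perm (Position m k l) :=
  Equiv.sumCongr
    ⟨fun p => (p.1, p.2 == σ p.1), fun p => (p.1, p.2 == σ p.1),
      fun p => by cases h : p.2 <;> cases h' : σ p.1 <;> ext <;> simp [h, h'],
      fun p => by cases h : p.2 <;> cases h' : σ p.1 <;> ext <;> simp [h, h']⟩
    (Equiv.refl _)

theorem mem_sample {e : Position m k l ≃ V} {v : V} :
    v ∈ sample e ↔ (e.symm v).IsSampled = true := by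
  simp [sample]

theorem mem_touched {e : Position m k l ≃ V} {v : V} :
    v ∈ touched e ↔ (e.symm v).IsTouched = true := by
  simp [touched]

theorem sum_sample (e : Position m k l ≃ V) (f : V → ℝ) :
    ∑ v ∈ sample e, f v = ∑ x with IsSampled x = true, f (e x) := by
  rw [sample, Finset.sum_filter, Finset.sum_filter]
  exact (Fintype.sum_equiv e _ _ fun x => by simp).symm

theorem card_isSampled : #{x : Position m k l | IsSampled x = true} = m + k := by
  rw [Finset.card_filter]
  simp only [Fintype.sum_sum_type, Fintype.sum_prod_type]
  simp [IsSampled]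

theorem card_not_isSampled : #{x : Position m k l | IsSampled x = false} = m + l := by
  rw [Finset.card_filter]
  simp only [Fintype.sum_sum_type, Fintype.sum_prod_type]
  simp [IsSampled]

theorem card_sample (e : Position m k l ≃ V) : #(sample e) = m + k := by
  have := sum_sample e fun _ => 1
  simp only [Finset.sum_const, card_isSampled, nsmul_eq_mul, mul_one] at this
  exact_mod_cast this

theorem card_touched (e : Position m k l ≃ V) : #(touched e) = 2 * m + k := by
  have h1 : #(touched e) = #{x : Position m k l | IsTouched x = true} := by
    rw [touched, Finset.card_filter, Finset.card_filter]
    exact (Fintype.sum_equiv e _ _ fun x => by simp).symm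
  rw [h1]
  rw [Finset.card_filter]
  simp only [Fintype.sum_sum_type, Fintype.sum_prod_type]
  simp [IsTouched, mul_comm]

theorem sample_flipPairs_subset (σ : Fin m → Bool) (e : Position m k l ≃ V) :
    sample ((flipPairs σ).trans e) ⊆ touched e := by
  intro v hv
  obtain ⟨x, rfl⟩ := ((flipPairs σ).trans e).surjective v
  rw [mem_sample, Equiv.symm_apply_apply] at hv
  rw [mem_touched, Equiv.trans_apply, Equiv.symm_apply_apply]
  rcases x with p | p | p
  · rfl
  · rfl
  · simp [IsSampled] at hv

variable [DecidableEq V]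

theorem sum_sample_compl (e : Position m k l ≃ V) (f : V → ℝ) :
    ∑ v ∈ (sample e)ᶜ, f v = ∑ x with IsSampled x = false, f (e x) := by
  rw [sample, Finset.compl_filter, Finset.sum_filter, Finset.sum_filter]
  exact (Fintype.sum_equiv e _ _ fun x => by simp).symm

/-- Exchanging two sampled, or two unsampled, positions does not change the sample, so that all
positions of one kind have the same law given the sample. -/
theorem sum_bijections_eq_of_isSampled_eq (g : Finset V → V → ℝ) {x y : Position m k l}
    (hxy : x.IsSampled = y.IsSampled) :
    ∑ e : Position m k l ≃ V, g (sample e) (e x) = ∑ e, g (sample e) (e y) := by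
  refine Fintype.sum_equiv (Equiv.equivCongr (Equiv.swap x y) (Equiv.refl V)) _ _ fun e => ?_
  have hs : sample (Equiv.equivCongr (Equiv.swap x y) (Equiv.refl V) e) = sample e := by
    ext v
    rw [mem_sample, mem_sample]
    simp only [Equiv.equivCongr, Equiv.coe_fn_mk, Equiv.symm_trans_apply,
      Equiv.symm_symm, Equiv.refl_symm, Equiv.refl_apply]
    rw [Equiv.swap_apply_def]
    split_ifs with h1 h2 <;> simp_all
  rw [hs]
  simp

theorem sum_bijections_sampled (g : Finset V → V → ℝ) {x : Position m k l}
    (hx : x.IsSampled = true) :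
    ((m + k : ℕ) : ℝ) * ∑ e : Position m k l ≃ V, g (sample e) (e x) =
      ∑ e : Position m k l ≃ V, ∑ v ∈ sample e, g (sample e) v := by
  simp only [sum_sample]
  rw [Finset.sum_comm, Finset.sum_congr rfl fun y hy =>
    sum_bijections_eq_of_isSampled_eq g ((mem_filter.1 hy).2.trans hx.symm), Finset.sum_const,
    card_isSampled, nsmul_eq_mul]

theorem sum_bijections_not_sampled (g : Finset V → V → ℝ) {x : Position m k l}
    (hx : x.IsSampled = false) :
    ((m + l : ℕ) : ℝ) * ∑ e : Position m k l ≃ V, g (sample e) (e x) =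
      ∑ e : Position m k l ≃ V, ∑ v ∈ (sample e)ᶜ, g (sample e) v := by
  simp only [sum_sample_compl]
  rw [Finset.sum_comm, Finset.sum_congr rfl fun y hy =>
    sum_bijections_eq_of_isSampled_eq g ((mem_filter.1 hy).2.trans hx.symm), Finset.sum_const,
    card_not_isSampled, nsmul_eq_mul]

/-- The sampling error is, on average, the average difference within the pairs. -/
theorem sum_samplingError (φ : ℝ → ℝ) (h : Finset V → V → ℝ)
    (hV : Fintype.card V = 2 * m + k + l) (hm : 0 < m) :
    (m : ℝ) * ∑ e : Position m k l ≃ V, samplingError φ (sample e) (h (sample e)) =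
      (m + l) * ∑ e : Position m k l ≃ V, ∑ s : Fin m,
        (φ (h (sample e) (e (.inl (s, true)))) - φ (h (sample e) (e (.inl (s, false))))) := by
  set S := ∑ e : Position m k l ≃ V, ∑ v ∈ sample e, φ (h (sample e) v) with hS
  set U := ∑ e : Position m k l ≃ V, ∑ v ∈ (sample e)ᶜ, φ (h (sample e) v) with hU
  have hm' : (0 : ℝ) < m := by exact_mod_cast hm
  have hk : (0 : ℝ) ≤ k := k.cast_nonneg
  have hl : (0 : ℝ) ≤ l := l.cast_nonneg
  have h1 : ∀ s : Fin m, ∑ e : Position m k l ≃ V, φ (h (sample e) (e (.inl (s, true)))) =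
      S / (m + k) := fun s => by
    rw [eq_div_iff (by positivity), mul_comm, hS,
      ← sum_bijections_sampled (fun Q v => φ (h Q v)) (x := .inl (s, true)) rfl]
    push_cast
    rfl
  have h2 : ∀ s : Fin m, ∑ e : Position m k l ≃ V, φ (h (sample e) (e (.inl (s, false)))) =
      U / (m + l) := fun s => by
    rw [eq_div_iff (by positivity), mul_comm, hU,
      ← sum_bijections_not_sampled (fun Q v => φ (h Q v)) (x := .inl (s, false)) rfl]
    push_cast
    rfl
  have h3 : ∑ e : Position m k l ≃ V, samplingError φ (sample e) (h (sample e)) =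
      (2 * m + k + l) / (m + k) * S - (S + U) := by
    rw [hS, hU, ← Finset.sum_add_distrib, Finset.mul_sum, ← Finset.sum_sub_distrib]
    refine Finset.sum_congr rfl fun e _ => ?_
    rw [samplingError, card_sample, hV, Finset.sum_add_sum_compl]
    push_cast
    rfl
  rw [h3, Finset.sum_comm]
  simp only [Finset.sum_sub_distrib, h1, h2]
  simp only [Finset.sum_const, card_univ, Fintype.card_fin, nsmul_eq_mul]
  field_simp
  ring

/-- Symmetrization: exchanging the members of the pairs at random turns the differences within pairs
into Rademacher averages. The vectors `z Q` may depend on the sample; only the bound through the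
touched set, which the exchanges preserve, enters. -/
theorem sum_pair_differences_le {φ : ℝ → ℝ} (hφ : ∀ a b, |φ a - φ b| ≤ |a - b|)
    (J : Matrix V V ℝ) {M : ℝ} (hM : 0 ≤ M) (hJ : ∀ i j, |J i j| ≤ M) {r : ℝ} (hr : 0 ≤ r)
    (z : Finset V → V → ℝ) (hz : ∀ Q j, #Q = m + k → |z Q j| ≤ 1 + if j ∈ Q then r else 0) :
    ∑ e : Position m k l ≃ V, ∑ s : Fin m,
        (φ ((J *ᵥ z (sample e)) (e (.inl (s, true)))) -
          φ ((J *ᵥ z (sample e)) (e (.inl (s, false))))) ≤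
      Fintype.card (Position m k l ≃ V) *
        (2 * (√m * M * (Fintype.card V + r * (2 * m + k)))) := by
  set G : (Position m k l ≃ V) → ℝ := fun e => ∑ s : Fin m,
    (φ ((J *ᵥ z (sample e)) (e (.inl (s, true)))) -
      φ ((J *ᵥ z (sample e)) (e (.inl (s, false))))) with hG
  set B : ℝ := √m * M * (Fintype.card V + r * (2 * m + k)) with hB
  have hinv : ∀ σ : Fin m → Bool, ∑ e, G ((flipPairs σ).trans e) = ∑ e, G e := fun σ =>
    Fintype.sum_equiv (Equiv.equivCongr (flipPairs σ).symm (Equiv.refl V)) _ _ fun e => by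
      congr 1
  have hneg : ∀ a b, |(-φ a) - (-φ b)| ≤ |a - b| := fun a b => by
    rw [neg_sub_neg, abs_sub_comm]
    exact hφ a b
  have hpoint : ∀ e, ∑ σ : Fin m → Bool, G ((flipPairs σ).trans e) ≤ 2 ^ m * (2 * B) := by
    intro e
    set w : (Fin m → Bool) → V → ℝ := fun t => z (sample ((flipPairs t).trans e)) with hw
    set c : V → ℝ := fun j => 1 + if j ∈ touched e then r else 0 with hc
    have hwc : ∀ t j, |w t j| ≤ c j := fun t j => by
      refine (hz _ j (card_sample _)).trans ?_
      by_cases h : j ∈ sample ((flipPairs t).trans e)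
      · simp [hc, h, sample_flipPairs_subset t e h]
      · simp only [hc, h, if_false]
        split_ifs <;> linarith
    have hcsum : ∑ j, c j = Fintype.card V + r * (2 * m + k) := by
      simp only [hc, Finset.sum_add_distrib, Finset.sum_ite_mem, univ_inter, Finset.sum_const,
        card_touched, card_univ, nsmul_eq_mul]
      push_cast
      ring
    have hT := rademacher_lipschitz_linear_le hφ (fun s : Fin m => J (e (.inl (s, true)))) hM
      (fun s j => hJ _ j) w c hwc
    have hF := rademacher_lipschitz_linear_le hneg (fun s : Fin m => J (e (.inl (s, false)))) hM
      (fun s j => hJ _ j) w c hwc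
    rw [hcsum, ← hB] at hT hF
    have hle : ∀ σ : Fin m → Bool, G ((flipPairs σ).trans e) ≤
        (⨆ t, ∑ s, boolSign (σ s) * φ (((fun s : Fin m => J (e (.inl (s, true)))) *ᵥ w t) s)) +
        ⨆ t, ∑ s, boolSign (σ s) * -φ (((fun s : Fin m => J (e (.inl (s, false)))) *ᵥ w t) s) := by
      intro σ
      refine le_trans (le_of_eq ?_) (add_le_add
        (le_ciSup (f := fun t => ∑ s, boolSign (σ s) *
          φ (((fun s : Fin m => J (e (.inl (s, true)))) *ᵥ w t) s))
          (Set.finite_range _).bddAbove σ)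
        (le_ciSup (f := fun t => ∑ s, boolSign (σ s) *
          -φ (((fun s : Fin m => J (e (.inl (s, false)))) *ᵥ w t) s))
          (Set.finite_range _).bddAbove σ))
      rw [← Finset.sum_add_distrib]
      refine Finset.sum_congr rfl fun s _ => ?_
      change φ ((J *ᵥ w σ) (e (.inl (s, true == σ s)))) -
        φ ((J *ᵥ w σ) (e (.inl (s, false == σ s)))) =
        boolSign (σ s) * φ ((J *ᵥ w σ) (e (.inl (s, true)))) +
          boolSign (σ s) * -φ ((J *ᵥ w σ) (e (.inl (s, false))))
      cases σ s <;> simp [boolSign] <;> ring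
    refine (Finset.sum_le_sum fun σ _ => hle σ).trans ?_
    rw [Finset.sum_add_distrib]
    linarith
  have htotal : (2 : ℝ) ^ m * ∑ e, G e ≤
      2 ^ m * (Fintype.card (Position m k l ≃ V) * (2 * B)) := by
    calc (2 : ℝ) ^ m * ∑ e, G e
        = ∑ σ : Fin m → Bool, ∑ e, G ((flipPairs σ).trans e) := by simp [hinv]
      _ = ∑ e, ∑ σ : Fin m → Bool, G ((flipPairs σ).trans e) := Finset.sum_comm
      _ ≤ ∑ _e : Position m k l ≃ V, 2 ^ m * (2 * B) := Finset.sum_le_sum fun e _ => hpoint e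
      _ = _ := by
        rw [Finset.sum_const, card_univ, nsmul_eq_mul]
        ring
  exact le_of_mul_le_mul_left htotal (by positivity)

/-- A permutation of `V` that carries `Q` to `Q'` carries the bijections with sample `Q` to bijections
with sample `Q'`. -/
theorem card_fiber_le {Q Q' : Finset V} (hQ : #Q = #Q') :
    #{e : Position m k l ≃ V | sample e = Q} ≤ #{e : Position m k l ≃ V | sample e = Q'} := by
  let ρ : Equiv.Perm V := (Finset.equivOfCardEq hQ).extendSubtype
  have hρ : ∀ v, ρ v ∈ Q' ↔ v ∈ Q := fun v =>
    ⟨fun h => by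
      by_contra hv
      exact Equiv.extendSubtype_not_mem (Finset.equivOfCardEq hQ) v hv h,
      fun h => Equiv.extendSubtype_mem (Finset.equivOfCardEq hQ) v h⟩
  refine Finset.card_le_card_of_injOn (fun e => e.trans ρ) (fun e he => ?_)
    fun e _ e' _ h => Equiv.ext fun x => ρ.injective (Equiv.congr_fun h x)
  simp only [coe_filter, mem_univ, true_and, Set.mem_ofPred_eq] at he ⊢
  ext v
  obtain ⟨u, rfl⟩ := ρ.surjective v
  rw [hρ, ← he, mem_sample, mem_sample]
  simp

/-- The sample of a uniformly random bijection is a uniformly random subset. -/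
theorem card_mul_sum_powersetCard (hV : Fintype.card V = 2 * m + k + l) (F : Finset V → ℝ) :
    (Fintype.card (Position m k l ≃ V) : ℝ) * ∑ Q ∈ (univ : Finset V).powersetCard (m + k), F Q =
      #((univ : Finset V).powersetCard (m + k)) * ∑ e : Position m k l ≃ V, F (sample e) := by
  have hmaps : ∀ e ∈ (univ : Finset (Position m k l ≃ V)),
      sample e ∈ (univ : Finset V).powersetCard (m + k) := fun e _ =>
    mem_powersetCard.2 ⟨subset_univ _, card_sample e⟩
  obtain ⟨Q₀, hQ₀⟩ : ((univ : Finset V).powersetCard (m + k)).Nonempty :=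
    powersetCard_nonempty.2 (by rw [card_univ, hV]; omega)
  have hconst : ∀ Q ∈ (univ : Finset V).powersetCard (m + k),
      #{e : Position m k l ≃ V | sample e = Q} = #{e : Position m k l ≃ V | sample e = Q₀} :=
    fun Q hQ => by
      have h := (mem_powersetCard.1 hQ).2.trans (mem_powersetCard.1 hQ₀).2.symm
      exact le_antisymm (card_fiber_le h) (card_fiber_le h.symm)
  have hfib : ∀ F : Finset V → ℝ, ∑ e : Position m k l ≃ V, F (sample e) =
      #{e : Position m k l ≃ V | sample e = Q₀} *
        ∑ Q ∈ (univ : Finset V).powersetCard (m + k), F Q := fun F => by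
    rw [← Finset.sum_fiberwise_of_maps_to hmaps, Finset.mul_sum]
    refine Finset.sum_congr rfl fun Q hQ => ?_
    rw [Finset.sum_congr rfl fun e he => by rw [(mem_filter.1 he).2], Finset.sum_const,
      nsmul_eq_mul, hconst Q hQ]
  have hone := hfib fun _ => 1
  simp only [Finset.sum_const, card_univ, nsmul_eq_mul, mul_one] at hone
  rw [hfib, hone]
  ring

end Position

/-! ### The expected sampling error and the final estimate -/

theorem samplingError_univ {V : Type*} [Fintype V] [Nonempty V] (φ : ℝ → ℝ) (h : V → ℝ) :
    samplingError φ univ h = 0 := by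
  rw [samplingError, card_univ, div_self (by exact_mod_cast Fintype.card_ne_zero)]
  ring

/-- The expected sampling error at a random field `J z_Q` is `O(n² ‖J‖_∞ / √q)`, even though `z_Q`
may be chosen after seeing the sample `Q`. -/
theorem sum_samplingError_le {V : Type*} [Fintype V] [DecidableEq V] {φ : ℝ → ℝ}
    (hφ : ∀ a b, |φ a - φ b| ≤ |a - b|) (J : Matrix V V ℝ) {M : ℝ} (hM : 0 ≤ M)
    (hJ : ∀ i j, |J i j| ≤ M) {q : ℕ} (hq : 1 ≤ q) (hqV : q ≤ Fintype.card V)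
    (z : Finset V → V → ℝ)
    (hz : ∀ Q j, #Q = q → |z Q j| ≤ 1 + if j ∈ Q then (Fintype.card V : ℝ) / q else 0) :
    ∑ Q ∈ (univ : Finset V).powersetCard q, samplingError φ Q (J *ᵥ z Q) ≤
      #((univ : Finset V).powersetCard q) * (6 * (Fintype.card V : ℝ) ^ 2 * M / √q) := by
  rcases hqV.eq_or_lt with heq | hlt
  · have : Nonempty V := Fintype.card_pos_iff.1 (by omega)
    rw [Finset.sum_eq_zero fun Q hQ => ?_]
    · positivity
    · rw [(Finset.card_eq_iff_eq_univ Q).1 ((mem_powersetCard.1 hQ).2.trans heq),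
        samplingError_univ]
  set n := Fintype.card V with hn
  obtain ⟨m, k, l, hm, rfl, hnl, hml⟩ : ∃ m k l : ℕ, 0 < m ∧ q = m + k ∧ n = 2 * m + k + l ∧
      (k = 0 ∨ l = 0) :=
    ⟨min q (n - q), q - min q (n - q), n - q - min q (n - q), by omega, by omega, by omega,
      by omega⟩
  have hN : 0 < Fintype.card (Position m k l ≃ V) :=
    Fintype.card_pos_iff.2 ⟨Fintype.equivOfCardEq (by
      simp only [Fintype.card_sum, Fintype.card_prod, Fintype.card_fin, Fintype.card_bool]
      omega)⟩
  have h1 := Position.card_mul_sum_powersetCard (hn.symm.trans hnl)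
    fun Q => samplingError φ Q (J *ᵥ z Q)
  have h2 := Position.sum_samplingError φ (fun Q => J *ᵥ z Q) (hn.symm.trans hnl) hm
  have h3 := Position.sum_pair_differences_le (l := l) hφ J hM hJ
    (r := (n : ℝ) / ((m + k : ℕ) : ℝ)) (by positivity) z hz
  rw [← hn] at h3
  set N : ℝ := ((Fintype.card (Position m k l ≃ V) : ℕ) : ℝ) with hNdef
  set S := ∑ e : Position m k l ≃ V,
    samplingError φ (Position.sample e) (J *ᵥ z (Position.sample e)) with hS
  have hN' : 0 < N := Nat.cast_pos.2 hN
  have hm' : (0 : ℝ) < m := by exact_mod_cast hm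
  have hk : (0 : ℝ) ≤ k := k.cast_nonneg
  have hl : (0 : ℝ) ≤ l := l.cast_nonneg
  have hn' : (n : ℝ) = 2 * m + k + l := by exact_mod_cast hnl
  have hqpos : 0 < √((m + k : ℕ) : ℝ) := Real.sqrt_pos.2 (by push_cast; positivity)
  -- both for a small and for a large sample, `n - q` is controlled by the number of pairs
  have hsqrt : (m + l) * √((m + k : ℕ) : ℝ) ≤ n * √m := by
    rcases hml with rfl | rfl
    · rw [add_zero, hn']
      gcongr
      simp only [Nat.cast_zero]
      linarith
    · have h4 : √m * √((m + k : ℕ) : ℝ) ≤ n := by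
        rw [← Real.sqrt_mul (Nat.cast_nonneg m)]
        refine Real.sqrt_le_iff.2 ⟨by positivity, ?_⟩
        rw [hn']
        push_cast
        nlinarith
      calc ((m : ℝ) + (0 : ℕ)) * √((m + k : ℕ) : ℝ)
          = (√m * √m) * √((m + k : ℕ) : ℝ) := by
            rw [Real.mul_self_sqrt hm'.le, Nat.cast_zero, add_zero]
        _ = (√m * √((m + k : ℕ) : ℝ)) * √m := by ring
        _ ≤ _ := by gcongr
  have hmass : (n : ℝ) + n / ((m + k : ℕ) : ℝ) * (2 * m + k) ≤ 3 * n := by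
    have : (n : ℝ) / ((m + k : ℕ) : ℝ) * (2 * m + k) ≤ 2 * n := by
      rw [div_mul_eq_mul_div, div_le_iff₀ (by push_cast; positivity)]
      push_cast
      nlinarith [(Nat.cast_nonneg n : (0 : ℝ) ≤ n), mul_nonneg (Nat.cast_nonneg n : (0 : ℝ) ≤ n) hk]
    linarith
  have hSle : S ≤ N * (6 * (n : ℝ) ^ 2 * M / √((m + k : ℕ) : ℝ)) := by
    refine le_of_mul_le_mul_left ?_ hm'
    rw [h2]
    calc ((m : ℝ) + l) * _
        ≤ (m + l) * (N * (2 * (√m * M * (n + n / ((m + k : ℕ) : ℝ) * (2 * m + k))))) := by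
          gcongr
      _ ≤ (m + l) * (N * (2 * (√m * M * (3 * n)))) := by gcongr
      _ = ((m + l) * √((m + k : ℕ) : ℝ)) * (6 * N * √m * M * n / √((m + k : ℕ) : ℝ)) := by
          field_simp
          ring
      _ ≤ (n * √m) * (6 * N * √m * M * n / √((m + k : ℕ) : ℝ)) := by gcongr
      _ = (√m * √m) * (N * (6 * (n : ℝ) ^ 2 * M / √((m + k : ℕ) : ℝ))) := by ring
      _ = _ := by rw [Real.mul_self_sqrt hm'.le]
  refine le_of_mul_le_mul_left ?_ hN'
  rw [h1, mul_left_comm]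
  gcongr

/-- Markov's inequality for the largest sampling error: few samples `Q` admit an admissible `z` with
sampling error above `t`. -/
theorem card_filter_samplingError_le {V : Type*} [Fintype V] [DecidableEq V] {φ : ℝ → ℝ}
    (hφ : ∀ a b, |φ a - φ b| ≤ |a - b|) (J : Matrix V V ℝ) {M : ℝ} (hM : 0 ≤ M)
    (hJ : ∀ i j, |J i j| ≤ M) {q : ℕ} (hq : 1 ≤ q) (hqV : q ≤ Fintype.card V) {t : ℝ}
    (ht : 80 * (6 * (Fintype.card V : ℝ) ^ 2 * M / √q) ≤ t) (B : Finset (Finset V))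
    (hB : B ⊆ (univ : Finset V).powersetCard q)
    (hex : ∀ Q ∈ B, ∃ z : V → ℝ,
      (∀ j, |z j| ≤ 1 + if j ∈ Q then (Fintype.card V : ℝ) / q else 0) ∧
        t < samplingError φ Q (J *ᵥ z)) :
    80 * (#B : ℝ) ≤ #((univ : Finset V).powersetCard q) := by
  -- outside `B` the choice `z = 0` makes the sampling error vanish, so that no positive part is needed
  have hsel : ∀ Q, ∃ z : V → ℝ,
      (∀ j, |z j| ≤ 1 + if j ∈ Q then (Fintype.card V : ℝ) / q else 0) ∧
        (Q ∈ B → t < samplingError φ Q (J *ᵥ z)) ∧ (Q ∉ B → z = 0) := by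
    intro Q
    by_cases h : Q ∈ B
    · obtain ⟨z, hz, hzt⟩ := hex Q h
      exact ⟨z, hz, fun _ => hzt, fun h' => absurd h h'⟩
    · refine ⟨0, fun j => ?_, fun h' => absurd h' h, fun _ => rfl⟩
      simp only [Pi.zero_apply, abs_zero]
      split_ifs <;> positivity
  choose z hz hzB hz0 using hsel
  have hsum := sum_samplingError_le hφ J hM hJ hq hqV z fun Q j _ => hz Q j
  have hoff : ∀ Q ∈ (univ : Finset V).powersetCard q, Q ∉ B →
      samplingError φ Q (J *ᵥ z Q) = 0 := by
    intro Q hQ h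
    have hcard := (mem_powersetCard.1 hQ).2
    have hq0 : (q : ℝ) ≠ 0 := by positivity
    simp [samplingError, hz0 Q h, hcard]
    field_simp
    ring
  rw [← Finset.sum_subset hB hoff] at hsum
  have ht0 : 0 ≤ t := le_trans (by positivity) ht
  have hlow : (#B : ℝ) * t ≤ ∑ Q ∈ B, samplingError φ Q (J *ᵥ z Q) := by
    rw [← nsmul_eq_mul]
    exact Finset.card_nsmul_le_sum _ _ _ fun Q hQ => (hzB Q hQ).le
  rcases ht0.eq_or_lt with h0 | hpos
  · -- for `t = 0` the errors counted by `B` are positive, but their sum is not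
    have hEmpty : B = ∅ := by
      by_contra hne
      have h1 : 0 < ∑ Q ∈ B, samplingError φ Q (J *ᵥ z Q) :=
        Finset.sum_pos (fun Q hQ => h0 ▸ hzB Q hQ) (nonempty_iff_ne_empty.2 hne)
      have h2 : 6 * (Fintype.card V : ℝ) ^ 2 * M / √q ≤ 0 := by linarith
      have h3 := mul_nonpos_of_nonneg_of_nonpos
        (Nat.cast_nonneg (α := ℝ) #((univ : Finset V).powersetCard q)) h2
      linarith
    simp [hEmpty]
  · refine le_of_mul_le_mul_right ?_ hpos
    calc 80 * (#B : ℝ) * t = 80 * (#B * t) := by ring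
      _ ≤ 80 * (#((univ : Finset V).powersetCard q) *
            (6 * (Fintype.card V : ℝ) ^ 2 * M / √q)) := by
          linarith [hlow.trans hsum]
      _ = #((univ : Finset V).powersetCard q) *
            (80 * (6 * (Fintype.card V : ℝ) ^ 2 * M / √q)) := by ring
      _ ≤ _ := by gcongr

theorem abs_le_maxEntry {V : Type*} [Finite V] (J : Matrix V V ℝ) (i j : V) :
    |J i j| ≤ maxEntry J :=
  le_ciSup (f := fun p : V × V => |J p.1 p.2|) (Set.finite_range _).bddAbove (i, j)

theorem maxEntry_nonneg {V : Type*} (J : Matrix V V ℝ) : 0 ≤ maxEntry J :=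
  Real.iSup_nonneg fun _ => abs_nonneg _

/-- The sample size suffices for an error of order `ε²`, in the form `480 / √q ≤ 2000 ε²`. For
`ε ≥ 1/2`, where `log (1/ε)` may vanish, `q ≥ 1` is enough. -/
theorem le_sq_mul_sqrt {ε q : ℝ} (hε : 0 < ε) (hq : 1 ≤ q)
    (h : 128000 * (Real.log (1 / ε) / ε ^ 8) ≤ q) : 6 / 25 ≤ ε ^ 2 * √q := by
  rcases le_total (1 / 2) ε with h2 | h2
  · have h1 : 1 ≤ √q := Real.one_le_sqrt.2 hq
    nlinarith
  · have hlog : 1 / 2 ≤ Real.log (1 / ε) := by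
      have := Real.one_sub_inv_le_log_of_pos (x := 1 / ε) (by positivity)
      rw [one_div ε, inv_inv] at this
      rw [one_div ε]
      linarith
    have h8 : 1 / ε ^ 8 ≤ q := by
      refine le_trans ?_ h
      rw [mul_div_assoc']
      gcongr
      linarith
    have h4 : 1 / ε ^ 4 ≤ √q := by
      refine Real.le_sqrt_of_sq_le (le_of_eq_of_le ?_ h8)
      rw [div_pow, one_pow, ← pow_mul]
    calc (6 : ℝ) / 25 ≤ 1 := by norm_num
      _ ≤ 1 / ε ^ 2 := by
          rw [le_div_iff₀ (by positivity)]
          nlinarith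
      _ = ε ^ 2 * (1 / ε ^ 4) := by field_simp
      _ ≤ _ := by gcongr

theorem mainTheorem2 (n q : ℕ) (hq : 1 ≤ q) (hqn : q ≤ n)
    (J : Matrix (Fin n) (Fin n) ℝ) (hsymm : J.IsSymm) (hdiag : ∀ i, J i i = 0)
    (ε ω : ℝ) (hε : 0 < ε) (hε1 : ε ≤ 1) (hω : ω = Real.log (1 / ε) / ε ^ 8)
    (hqω : 128000 * ω ≤ (q : ℝ)) :
    39 / 40 ≤ randomSubsetProb n q (fun Q =>
      |variationalFreeEnergy J - (n : ℝ) / (q : ℝ) * variationalFreeEnergy (sampledMatrix J Q)| ≤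
        2000 * ε * n * (frobNorm J + ε * n * maxEntry J + ω / q)) := by
  classical
  set M := maxEntry J with hMdef
  have hM : 0 ≤ M := maxEntry_nonneg J
  have hJ : ∀ i j, |J i j| ≤ M := abs_le_maxEntry J
  set t : ℝ := 2000 * ε * n * (ε * n * M) with ht
  set T : ℝ := 2000 * ε * n * (frobNorm J + ε * n * M + ω / q) with hT
  have htT : t ≤ T := by
    have h1 : 0 ≤ frobNorm J := Real.sqrt_nonneg _
    have h2 : 0 ≤ ω / q := by
      rw [hω]
      have : 0 ≤ Real.log (1 / ε) :=
        Real.log_nonneg (by rw [one_div]; exact one_le_inv₀ hε |>.2 hε1)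
      positivity
    rw [ht, hT]
    gcongr
    linarith
  have hmarkov : 80 * (6 * (Fintype.card (Fin n) : ℝ) ^ 2 * M / √q) ≤ t := by
    have hs : 0 < √(q : ℝ) := Real.sqrt_pos.2 (by positivity)
    have h1 := le_sq_mul_sqrt hε (by exact_mod_cast hq) (hω ▸ hqω)
    rw [Fintype.card_fin, ht, mul_div_assoc', div_le_iff₀ hs]
    have h2 := mul_le_mul_of_nonneg_right h1 (by positivity : 0 ≤ 2000 * (n : ℝ) ^ 2 * M)
    linarith
  have hneg : ∀ a b, |(-spinFreeEnergy a) - (-spinFreeEnergy b)| ≤ |a - b| := fun a b => by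
    rw [neg_sub_neg, abs_sub_comm]
    exact abs_spinFreeEnergy_sub_le a b
  set P := (univ : Finset (Fin n)).powersetCard q with hP
  set d : Finset (Fin n) → ℝ := fun Q =>
    variationalFreeEnergy J - (n : ℝ) / (q : ℝ) * variationalFreeEnergy (sampledMatrix J Q) with hd
  have hover := card_filter_samplingError_le abs_spinFreeEnergy_sub_le J hM hJ hq
    (by simpa using hqn) hmarkov (P.filter fun Q => d Q < -T) (filter_subset _ _) (by
      intro Q hQ
      obtain ⟨hQP, hQT⟩ := mem_filter.1 hQ
      obtain ⟨z, hz, hle⟩ := sampled_sub_full_le hsymm hdiag Q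
      rw [(mem_powersetCard.1 hQP).2] at hz hle
      refine ⟨z, by simpa using hz, ?_⟩
      simp only [hd] at hQT
      linarith)
  have hunder := card_filter_samplingError_le hneg J hM hJ hq
    (by simpa using hqn) hmarkov (P.filter fun Q => T < d Q) (filter_subset _ _) (by
      intro Q hQ
      obtain ⟨hQP, hQT⟩ := mem_filter.1 hQ
      obtain ⟨z, hz, hle⟩ := full_sub_sampled_le hsymm hdiag Q
      rw [(mem_powersetCard.1 hQP).2] at hz hle
      refine ⟨z, by simpa using hz, ?_⟩
      have hflip : samplingError (fun a => -spinFreeEnergy a) Q (J *ᵥ z) =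
          -samplingError spinFreeEnergy Q (J *ᵥ z) := by
        simp only [samplingError, Finset.sum_neg_distrib]
        ring
      rw [hflip]
      simp only [hd] at hQT
      linarith)
  have hcover : #P ≤ #(P.filter fun Q => |d Q| ≤ T) +
      (#(P.filter fun Q => d Q < -T) + #(P.filter fun Q => T < d Q)) := by
    refine le_trans (card_le_card ?_) ((card_union_le _ _).trans
      (Nat.add_le_add_left (card_union_le _ _) _))
    intro Q hQ
    simp only [mem_union, mem_filter, hQ, true_and, abs_le]
    by_contra! h
    linarith [h.1 h.2.1, h.2.2]
  have hPpos : 0 < #P := card_pos.2 (powersetCard_nonempty.2 (by simpa using hqn))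
  have hcover' : (#P : ℝ) ≤ #(P.filter fun Q => |d Q| ≤ T) +
      (#(P.filter fun Q => d Q < -T) + #(P.filter fun Q => T < d Q)) := by exact_mod_cast hcover
  rw [randomSubsetProb, le_div_iff₀ (by exact_mod_cast hPpos)]
  -- `randomSubsetProb` filters with the classical decidability instance
  have hcongr : #(P.filter fun Q => |d Q| ≤ T) = _ := Finset.card_bij (fun Q _ => Q)
    (t := @Finset.filter _ (fun Q => |d Q| ≤ T) (fun a => Classical.propDecidable _) P)
    (fun Q h => by simpa using h) (fun _ _ _ _ h => h) (fun Q h => ⟨Q, by simpa using h, rfl⟩)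
  rw [hcongr] at hcover'
  linarith
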